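/- Let $k\ge 1$ and $1\le r\le k$ be integers with $\gcd(r,k)=1$, and put $n=2k$. For $0\le i\le 2^r-1$ let $d_i=(i2^{k-r}+1)(2^k-1)+1$, and for $x\in\mathbb{F}_{2^n}$ let $$G(x)=\sum_{i=1}^{2^r-1}x^{d_i}.$$ Write $\mathrm{Tr}^m_1$ for the trace from $\mathbb{F}_{2^m}$ to $\mathbb{F}_2$. For $f:\mathbb{F}_{2^n}\to\mathbb{F}_2$ let $W_f(a)=\sum_{x\in\mathbb{F}_{2^n}}(-1)^{f(x)+\mathrm{Tr}^n_1(ax)}$; $f$ is called bent if $|W_f(a)|=2^{n/2}$ for all $a\in\mathbb{F}_{2^n}$, and its dual is then the function $f^*:\mathbb{F}_{2^n}\to\mathbb{F}_2$ with $W_f(a)=2^{n/2}(-1)^{f^*(a)}$ for all $a$. Let $D_af(x)=f(x)+f(x+a)$. Then: 1. $G(x)\in\mathbb{F}_{2^k}$ for all $x\in\mathbb{F}_{2^n}$, and $G:\mathbb{F}_{2^n}\to\mathbb{F}_{2^k}$ is vectorial bent: for every $\lambda\in\mathbb{F}_{2^k}^*$ the component $G_\lambda(x)=\mathrm{Tr}^k_1(\lambda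 G(x))$ is bent. 2. Let $t=2^{r-1}-1$, so that $d_t=((2^{r-1}-1)2^{k-r}+1)(2^k-1)+1$. For every $\lambda\in\mathbb{F}_{2^k}^*$ there is a unique $\delta\in\mathbb{F}_{2^n}$ with $\lambda=\delta^{d_t}$, and $G_\lambda^*(x)=G_1^*(\delta^{-1}x)$ for all $x\in\mathbb{F}_{2^n}$. 3. For every $\lambda\in\mathbb{F}_{2^k}^*$ and all $a,b\in\mathbb{F}_{2^k}^*$, $D_aD_bG_\lambda^*(x)=0$ for all $x\in\mathbb{F}_{2^n}$. -/

import Mathlib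

namespace NihoBent

noncomputable section

/-- The Walsh transform `W_f(a) = ∑_{x ∈ L} (-1)^(f(x) + Tr(a x))` of a Boolean function `f` on a
finite field `L` of characteristic two, where `Tr` is the absolute trace of `L`. -/
def walsh {L : Type*} [Field L] [Fintype L] [Algebra (ZMod 2) L] (f : L → ZMod 2) (a : L) : ℤ :=
  ∑ x : L, (-1 : ℤ) ^ (f x + Algebra.trace (ZMod 2) L (a * x)).val

/-- A Boolean function on `L = 𝔽_{2^n}` is bent if `|W_f(a)| = 2^(n/2)` for all `a`. -/
def IsBent {L : Type*} [Field L] [Fintype L] [Algebra (ZMod 2) L] (f : L → ZMod 2) : Prop :=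
  ∀ a : L, |(walsh f a : ℝ)| = (2 : ℝ) ^ ((Module.finrank (ZMod 2) L : ℝ) / 2)

/-- The dual `f^*` of a bent function `f`, that is, the Boolean function with
`W_f(a) = 2^(n/2) (-1)^(f^*(a))` for all `a` (see `IsBent.walsh_eq_iff`). -/
def dual {L : Type*} [Field L] [Fintype L] [Algebra (ZMod 2) L] (f : L → ZMod 2) (a : L) :
    ZMod 2 :=
  if 0 ≤ walsh f a then 0 else 1

/-- For a bent function `f`, the function `dual f` is the one and only Boolean function `g`
with `W_f(a) = 2^(n/2) (-1)^(g(a))` for all `a`. -/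
theorem IsBent.walsh_eq_iff {L : Type*} [Field L] [Fintype L] [Algebra (ZMod 2) L]
    {f : L → ZMod 2} (hf : IsBent f) (g : L → ZMod 2) :
    (∀ a : L, (walsh f a : ℝ) =
      (2 : ℝ) ^ ((Module.finrank (ZMod 2) L : ℝ) / 2) * (-1 : ℝ) ^ (g a).val) ↔ g = dual f := by
  have hpos : (0 : ℝ) < (2 : ℝ) ^ ((Module.finrank (ZMod 2) L : ℝ) / 2) := by positivity
  have key : ∀ (a : L) (z : ZMod 2), (walsh f a : ℝ) =
      (2 : ℝ) ^ ((Module.finrank (ZMod 2) L : ℝ) / 2) * (-1 : ℝ) ^ z.val ↔ z = dual f a := by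
    intro a z
    have h := hf a
    unfold dual
    have hz : z = 0 ∨ z = 1 := by
      revert z
      decide
    have h1 : (1 : ZMod 2).val = 1 := rfl
    by_cases hs : 0 ≤ walsh f a
    · have hs' : (0 : ℝ) ≤ walsh f a := by exact_mod_cast hs
      rw [abs_of_nonneg hs'] at h
      rcases hz with rfl | rfl
      · simp [hs, h]
      · simp only [hs, h1, if_true, pow_one, one_ne_zero, iff_false]
        intro hc
        linarith
    · have hs' : (walsh f a : ℝ) < 0 := by exact_mod_cast not_le.mp hs
      rw [abs_of_neg hs'] at h
      rcases hz with rfl | rfl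
      · simp only [hs, ZMod.val_zero, if_false, pow_zero, zero_ne_one, iff_false]
        intro hc
        linarith
      · simp only [hs, h1, if_false, pow_one, iff_true]
        linarith
  constructor
  · intro h
    funext a
    exact (key a (g a)).1 (h a)
  · intro h a
    exact (key a (g a)).2 (congrFun h a)

/-- The component `F_c(x) = Tr(c F(x))` of `F : L → K`, where `Tr` is the absolute trace of `K`. -/
def component {K L : Type*} [Field K] [Algebra (ZMod 2) K] (c : K) (F : L → K) (x : L) : ZMod 2 :=
  Algebra.trace (ZMod 2) K (c * F x)

/-- `F : 𝔽_{2^n} → 𝔽_{2^m}` is vectorial bent if all its nonzero components are bent. -/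
def IsVectorialBent {K L : Type*} [Field K] [Algebra (ZMod 2) K] [Field L] [Fintype L]
    [Algebra (ZMod 2) L] (F : L → K) : Prop :=
  ∀ c : K, c ≠ 0 → IsBent (component c F)

/-- The derivative `D_a f(x) = f(x) + f(x + a)`. -/
def derivative {L : Type*} [Add L] (a : L) (f : L → ZMod 2) (x : L) : ZMod 2 :=
  f x + f (x + a)

/-- The Niho exponent `d_i = (i 2^(k-r) + 1)(2^k - 1) + 1`, for `r ≤ k`. -/
def nihoExponent (k r i : ℕ) : ℕ :=
  (i * 2 ^ (k - r) + 1) * (2 ^ k - 1) + 1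

/-- The function `∑_{i=1}^{2^r - 1} x^(d_i)`. -/
def nihoSum {L : Type*} [Field L] (k r : ℕ) (x : L) : L :=
  ∑ i ∈ Finset.Icc 1 (2 ^ r - 1), x ^ nihoExponent k r i

end

end NihoBent

/-!
Write `q = 2 ^ k`, `R = 2 ^ r`, and let `Tr` be the trace from `L` to `K`. All exponents `d_i` are
congruent to `1` modulo `q - 1`, so the Niho sum `G` is `K`-homogeneous and is determined by its
values at one point of each `K`-line of `L`. Choose `y ∈ L` with `Tr y = 1`, that is,
`y ^ q = y + 1`. Every element of `L` lies in `K`, where `G` is the identity, or is a `K`-multiple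
of `(z + y) ^ R` for a unique `z ∈ K`. As `2 ^ (k - r) * R = q`, the sum `G ((z + y) ^ R)` is
geometric with ratio `(z + y) / (z + y + 1)`, and it equals `(z + y) ^ R + (z + y)`
(`nihoSum_pow`); this lies in `K`.

By homogeneity the component of `G` at `c` has the Walsh transform of the component at `1` with
the argument divided by `c` (`walsh_component_eq`), and `δ = c` is the only solution of
`δ ^ (d_t) = c` (`algebraMap_eq_pow_nihoExponent_iff`). So it suffices to treat the component at
`1`. Summing over the lines, its Walsh value at `a` is `q` times one less than the number of
`K`-lines on which `G x + Tr (a x)` vanishes. For `Tr a ≠ 1` these lines correspond to the solutions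
`z ∈ K` of `τ z ^ R + z = C` with `τ = Tr a + 1` and `C = y ^ R + y + Tr (a y ^ R)`. The kernel of
`z ↦ τ z ^ R + z` has two elements because `gcd(R - 1, q - 1) = 1` (`card_ker_binomialMap`), hence
there are two solutions or none. For `Tr a = 1` there is one solution, and the line `K` is a
further zero. In all cases the value is `q` if `C` is in the range of this additive map, and `-q`
otherwise (`walsh_component_one`). So `G` is vectorial bent.

Replacing `a` by `a + e` with `e ∈ K` keeps `τ` and changes `C` to `C + e`. On the translates by
`K` the dual is therefore the indicator of the complement of a subgroup of `K` of index at most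
two (`add_mem_range_binomialMap_iff`), up to a translation. Such a function is affine, and its
second derivatives vanish.
-/

namespace NihoBent

/-! ### Character sums over a finite field of characteristic two -/

theorem neg_one_pow_val_add (s t : ZMod 2) :
    (-1 : ℤ) ^ (s + t).val = (-1) ^ s.val * (-1) ^ t.val := by
  revert s t
  decide

theorem sum_neg_one_pow_trace_mul {K : Type*} [Field K] [Fintype K] [DecidableEq K]
    [Algebra (ZMod 2) K] (p : K) :
    ∑ b : K, (-1 : ℤ) ^ (Algebra.trace (ZMod 2) K (b * p)).val =
      if p = 0 then (Fintype.card K : ℤ) else 0 := by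
  split_ifs with hp
  · simp [hp]
  · obtain ⟨c, hc⟩ := Algebra.trace_surjective (ZMod 2) K 1
    have h : ∑ b : K, (-1 : ℤ) ^ (Algebra.trace (ZMod 2) K (b * p)).val =
        ∑ b : K, (-1 : ℤ) ^ (Algebra.trace (ZMod 2) K ((b + c / p) * p)).val :=
      (Equiv.sum_comp (Equiv.addRight (c / p))
        fun b => (-1 : ℤ) ^ (Algebra.trace (ZMod 2) K (b * p)).val).symm
    have h1 : (1 : ZMod 2).val = 1 := rfl
    simp only [add_mul, div_mul_cancel₀ c hp, map_add, hc, neg_one_pow_val_add, h1,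
      ← Finset.sum_mul] at h
    linarith

/-! ### The linearized binomial `τ z ^ (2 ^ r) + z` -/

/-- The additive map `z ↦ τ z ^ (2 ^ r) + z` on a field of characteristic two. -/
def binomialMap {K : Type*} [Field K] [CharP K 2] (r : ℕ) (t : K) : K →+ K where
  toFun z := t * z ^ 2 ^ r + z
  map_zero' := by simp
  map_add' z w := by rw [add_pow_char_pow (p := 2) z w]; ring

theorem binomialMap_apply {K : Type*} [Field K] [CharP K 2] (r : ℕ) (t z : K) :
    binomialMap r t z = t * z ^ 2 ^ r + z := rfl

/-- Raising to the power `2 ^ r - 1` permutes `𝔽_{2^k}ˣ`, because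
`gcd(2 ^ r - 1, 2 ^ k - 1) = 2 ^ gcd(r, k) - 1 = 1`. -/
theorem pow_two_pow_sub_one_bijective {K : Type*} [Field K] [Fintype K] {k r : ℕ}
    (hgcd : Nat.gcd r k = 1) (hK : Fintype.card K = 2 ^ k) :
    Function.Bijective fun u : Kˣ => u ^ (2 ^ r - 1) := by
  refine Nat.Coprime.pow_left_bijective ?_
  rw [Nat.card_units, Nat.card_eq_fintype_card, hK, Nat.coprime_comm, Nat.Coprime,
    Nat.pow_sub_one_gcd_pow_sub_one, hgcd]
  norm_num

theorem card_ker_binomialMap {K : Type*} [Field K] [Fintype K] [CharP K 2] {k r : ℕ}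
    (hgcd : Nat.gcd r k = 1) (hK : Fintype.card K = 2 ^ k) {t : K} (ht : t ≠ 0) :
    Nat.card (binomialMap r t).ker = 2 := by
  have hb := pow_two_pow_sub_one_bijective hgcd hK
  obtain ⟨w, hw⟩ := hb.2 (Units.mk0 t ht)⁻¹
  have hw' : (w : K) ^ (2 ^ r - 1) = t⁻¹ := by
    have := congrArg Units.val hw
    simpa using this
  have hfac : ∀ z : K, t * z ^ 2 ^ r + z = z * (t * z ^ (2 ^ r - 1) + 1) := by
    intro z
    obtain ⟨m, hm⟩ : ∃ m, 2 ^ r = m + 1 :=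
      ⟨2 ^ r - 1, (Nat.sub_add_cancel Nat.one_le_two_pow).symm⟩
    rw [hm, Nat.add_sub_cancel]
    ring
  have hker : ((binomialMap r t).ker : Set K) = {0, (w : K)} := by
    ext z
    simp only [SetLike.mem_coe, AddMonoidHom.mem_ker, binomialMap_apply, hfac, mul_eq_zero,
      Set.mem_insert_iff, Set.mem_singleton_iff]
    refine or_congr_right' fun hz => ?_
    rw [CharTwo.add_eq_zero]
    constructor
    · intro h
      have : Units.mk0 z hz = w := hb.1 <| by
        ext
        simpa [hw'] using eq_inv_of_mul_eq_one_right h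
      rw [← this, Units.val_mk0]
    · rintro rfl
      rw [hw', mul_inv_cancel₀ ht]
  rw [← SetLike.coe_sort_coe, hker, Nat.card_coe_set_eq, Set.ncard_pair w.ne_zero.symm]

theorem card_fiber_binomialMap {K : Type*} [Field K] [Fintype K] [DecidableEq K] [CharP K 2]
    {k r : ℕ} (hgcd : Nat.gcd r k = 1) (hK : Fintype.card K = 2 ^ k) {t c : K} (ht : t ≠ 0)
    (hc : c ∈ (binomialMap r t).range) :
    (Finset.univ.filter fun z => binomialMap r t z = c).card = 2 := by
  rw [AddMonoidHom.card_fiber_eq_of_mem_range (binomialMap r t) hc ⟨0, map_zero _⟩,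
    ← card_ker_binomialMap hgcd hK ht, ← SetLike.coe_sort_coe, Nat.card_coe_set_eq,
    ← Set.ncard_coe_finset]
  congr 1
  ext z
  simp [AddMonoidHom.mem_ker]

/-- The range of the binomial map contains the sum of any two elements that both lie outside it,
as its index is at most two. -/
theorem add_mem_range_binomialMap_iff {K : Type*} [Field K] [Fintype K] [CharP K 2] {k r : ℕ}
    (hgcd : Nat.gcd r k = 1) (hK : Fintype.card K = 2 ^ k) (t : K) {a b : K} :
    a + b ∈ (binomialMap r t).range ↔
      (a ∈ (binomialMap r t).range ↔ b ∈ (binomialMap r t).range) := by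
  by_cases ht : t = 0
  · have h : ∀ c, c ∈ (binomialMap r t).range := fun c => ⟨c, by simp [binomialMap_apply, ht]⟩
    simp [h]
  · refine AddSubgroup.add_mem_iff_of_index_two ?_
    have h1 := (binomialMap r t).ker.card_mul_index
    have h2 := (binomialMap r t).range.card_mul_index
    rw [AddSubgroup.index_ker, card_ker_binomialMap hgcd hK ht, ← h2, mul_comm] at h1
    exact (Nat.eq_of_mul_eq_mul_left Nat.card_pos h1).symm

/-- The indicator of the complement of a subgroup of index at most two is additive, so the second
derivatives of its translates vanish. -/
theorem sum_indicator_compl_eq_zero {A : Type*} [AddGroup A] {H : AddSubgroup A}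
    [DecidablePred (· ∈ H)] (hH : ∀ a b, a + b ∈ H ↔ (a ∈ H ↔ b ∈ H)) (c a b : A) :
    ((if c ∈ H then 0 else 1) + (if c + b ∈ H then 0 else 1) +
      ((if c + a ∈ H then 0 else 1) + (if c + (a + b) ∈ H then 0 else 1)) : ZMod 2) = 0 := by
  simp only [hH]
  by_cases h1 : c ∈ H <;> by_cases h2 : a ∈ H <;> by_cases h3 : b ∈ H <;>
    simp [h1, h2, h3, CharTwo.add_self_eq_zero]

/-! ### Values of the Niho sum -/

variable {L : Type*} [Field L] {k r : ℕ}

theorem pow_nihoExponent_of_pow_eq {c : L} (hc : c ^ 2 ^ k = c) (i : ℕ) :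
    c ^ nihoExponent k r i = c := by
  unfold nihoExponent
  by_cases h0 : c = 0
  · simp [h0]
  · have h1 : c ^ (2 ^ k - 1) = 1 := by
      refine mul_right_cancel₀ h0 ?_
      rw [← pow_succ, Nat.sub_add_cancel Nat.one_le_two_pow, hc, one_mul]
    rw [pow_succ, mul_comm _ (2 ^ k - 1), pow_mul, h1, one_pow, one_mul]

theorem nihoSum_mul {c : L} (hc : c ^ 2 ^ k = c) (x : L) :
    nihoSum k r (c * x) = c * nihoSum k r x := by
  simp only [nihoSum, mul_pow, pow_nihoExponent_of_pow_eq hc, Finset.mul_sum]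

theorem nihoSum_of_pow_eq [CharP L 2] (hr : 1 ≤ r) {c : L} (hc : c ^ 2 ^ k = c) :
    nihoSum k r c = c := by
  simp only [nihoSum, pow_nihoExponent_of_pow_eq hc, Finset.sum_const, Nat.card_Icc,
    Nat.add_sub_cancel, nsmul_eq_mul]
  rw [Nat.cast_sub Nat.one_le_two_pow]
  rw [Nat.cast_pow, Nat.cast_ofNat, CharTwo.two_eq_zero, zero_pow (by omega), Nat.cast_one,
    zero_sub, CharTwo.neg_eq, one_mul]

/-- On an element `y` with conjugate `y + 1` the Niho sum of `y ^ (2 ^ r)` is a geometric sum with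
ratio `y / (y + 1)`. -/
theorem nihoSum_pow [CharP L 2] (hrk : r ≤ k) {y : L} (hy : y ^ 2 ^ k = y + 1) :
    nihoSum k r (y ^ 2 ^ r) = y ^ 2 ^ r + y := by
  have hy0 : y ≠ 0 := by
    rintro rfl
    simp at hy
  have hy1 : y + 1 ≠ 0 := by
    rw [← hy]
    exact pow_ne_zero _ hy0
  have hy2 : (y + 1) ^ 2 ^ k = y := by
    rw [add_pow_char_pow (p := 2) y 1, hy, one_pow, add_assoc, CharTwo.add_self_eq_zero, add_zero]
  have hterm : ∀ i, (y ^ 2 ^ r) ^ nihoExponent k r i = (y + 1) ^ 2 ^ r * (y / (y + 1)) ^ i := by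
    intro i
    -- The power `y ^ (i * 2 ^ k)` clears the negative part of `d_i = s * 2 ^ k - s + 1`,
    -- where `s = i * 2 ^ (k - r) + 1`.
    have hexp : 2 ^ r * nihoExponent k r i + i * 2 ^ k = 2 ^ k * (2 ^ r + i * 2 ^ k) := by
      obtain ⟨m, hm⟩ : ∃ m, 2 ^ k = m + 1 :=
        ⟨2 ^ k - 1, (Nat.sub_add_cancel Nat.one_le_two_pow).symm⟩
      have hrs : 2 ^ r * 2 ^ (k - r) = m + 1 := by rw [← pow_add, Nat.add_sub_cancel' hrk, hm]
      rw [nihoExponent, hm, Nat.add_sub_cancel]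
      linear_combination (i * m : ℕ) * hrs
    have h : (y ^ 2 ^ r) ^ nihoExponent k r i * (y + 1) ^ i = (y + 1) ^ 2 ^ r * y ^ i := by
      calc (y ^ 2 ^ r) ^ nihoExponent k r i * (y + 1) ^ i
          = y ^ (2 ^ r * nihoExponent k r i + i * 2 ^ k) := by
            rw [← hy, pow_add, pow_mul, ← pow_mul y (2 ^ k) i, mul_comm i]
        _ = (y + 1) ^ 2 ^ r * y ^ i := by
            rw [hexp, pow_mul, hy, pow_add, mul_comm i, pow_mul, hy2]
    rw [div_pow, ← mul_div_assoc, eq_div_iff (pow_ne_zero _ hy1), h]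
  have hgeom : (∑ i ∈ Finset.Icc 1 (2 ^ r - 1), (y / (y + 1)) ^ i) + 1 =
      ((y / (y + 1)) ^ 2 ^ r + 1) * (y + 1) := by
    have h1 : (∑ i ∈ Finset.Icc 1 (2 ^ r - 1), (y / (y + 1)) ^ i) + 1 =
        ∑ i ∈ Finset.range (2 ^ r), (y / (y + 1)) ^ i := by
      rw [Finset.range_eq_Ico, Finset.sum_eq_sum_Ico_succ_bot (by positivity), pow_zero, add_comm]
      congr 2
    have h2 : y / (y + 1) - 1 = 1 / (y + 1) := by
      field_simp
      rw [sub_add_cancel_left, CharTwo.neg_eq]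
    have h3 := geom_sum_mul (y / (y + 1)) (2 ^ r)
    rw [h2, mul_one_div, div_eq_iff hy1, CharTwo.sub_eq_add] at h3
    rw [h1, h3]
  have hR : (y + 1) ^ 2 ^ r = y ^ 2 ^ r + 1 := by rw [add_pow_char_pow (p := 2) y 1, one_pow]
  simp only [nihoSum, hterm, ← Finset.mul_sum]
  rw [eq_sub_of_add_eq hgeom, div_pow]
  have : y ^ 2 ^ r + 1 ≠ 0 := hR ▸ pow_ne_zero _ hy1
  rw [hR]
  field_simp
  linear_combination (y ^ 2 ^ r * y) * CharTwo.two_eq_zero (R := L)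

/-! ### The quadratic extension -/

section quadratic

variable {K L : Type*} [Field K] [Fintype K] [Field L] [Algebra K L] {k r : ℕ}

theorem algebraMap_pow_two_pow (hK : Fintype.card K = 2 ^ k) (c : K) :
    algebraMap K L c ^ 2 ^ k = algebraMap K L c := by
  rw [← map_pow, ← hK, FiniteField.pow_card]

theorem finrank_eq_two [Fintype L] (hk : 1 ≤ k) (hK : Fintype.card K = 2 ^ k)
    (hL : Fintype.card L = 2 ^ (2 * k)) : Module.finrank K L = 2 := by
  have h := Module.card_eq_pow_finrank (K := K) (V := L)
  rw [hK, hL, ← pow_mul, mul_comm] at h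
  exact (Nat.eq_of_mul_eq_mul_left hk (Nat.pow_right_injective le_rfl h)).symm

theorem algebraMap_trace_eq_add_pow [Fintype L] (hk : 1 ≤ k) (hK : Fintype.card K = 2 ^ k)
    (hL : Fintype.card L = 2 ^ (2 * k)) (x : L) :
    algebraMap K L (Algebra.trace K L x) = x + x ^ 2 ^ k := by
  rw [FiniteField.algebraMap_trace_eq_sum_pow, finrank_eq_two hk hK hL, Finset.sum_range_succ,
    Finset.sum_range_one, pow_zero, pow_one, pow_one, Nat.card_eq_fintype_card, hK]

theorem exists_pow_eq_add_one [Fintype L] [CharP L 2] (hk : 1 ≤ k) (hK : Fintype.card K = 2 ^ k)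
    (hL : Fintype.card L = 2 ^ (2 * k)) : ∃ y : L, y ^ 2 ^ k = y + 1 := by
  obtain ⟨y, hy⟩ := Algebra.trace_surjective K L 1
  have h := algebraMap_trace_eq_add_pow hk hK hL y
  rw [hy, map_one] at h
  exact ⟨y, by rw [h, ← add_assoc, CharTwo.add_self_eq_zero, zero_add]⟩

/-- An element with conjugate `Y + 1` forms a basis of `L` over `K` together with `1`. -/
theorem bijective_add_mul [Fintype L] [CharP L 2] (hK : Fintype.card K = 2 ^ k)
    (hL : Fintype.card L = 2 ^ (2 * k)) {Y : L} (hY : Y ^ 2 ^ k = Y + 1) :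
    Function.Bijective fun p : K × K => algebraMap K L p.2 + algebraMap K L p.1 * Y := by
  rw [Fintype.bijective_iff_injective_and_card]
  refine ⟨?_, by rw [Fintype.card_prod, hK, hL, two_mul, pow_add]⟩
  rintro ⟨b, a⟩ ⟨b', a'⟩ h
  have h : algebraMap K L a + algebraMap K L b * Y = algebraMap K L a' + algebraMap K L b' * Y := h
  have h2 := congrArg (· ^ 2 ^ k) h
  simp only [add_pow_char_pow (p := 2) (_ : L) _, mul_pow, algebraMap_pow_two_pow hK, hY] at h2
  have hb : b = b' := (algebraMap K L).injective (by linear_combination h2 - h)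
  subst hb
  rw [add_left_inj] at h
  rw [(algebraMap K L).injective h]

theorem pow_two_pow_bijective [CharP K 2] (r : ℕ) : Function.Bijective fun z : K => z ^ 2 ^ r :=
  Finite.injective_iff_bijective.1 (iterateFrobenius_inj K 2 r)

theorem pow_two_pow_conj [CharP L 2] {y : L} (hy : y ^ 2 ^ k = y + 1) :
    (y ^ 2 ^ r) ^ 2 ^ k = y ^ 2 ^ r + 1 := by
  rw [← pow_mul, mul_comm, pow_mul, hy, add_pow_char_pow (p := 2) y 1, one_pow]

/-- The element `y ^ (2 ^ r) + y`, the value of the Niho sum at `y ^ (2 ^ r)`, lies in `K`. -/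
theorem exists_algebraMap_eq_pow_add [Fintype L] [CharP L 2] (hK : Fintype.card K = 2 ^ k)
    (hL : Fintype.card L = 2 ^ (2 * k)) {y : L} (hy : y ^ 2 ^ k = y + 1) :
    ∃ d : K, algebraMap K L d = y ^ 2 ^ r + y := by
  have hY := pow_two_pow_conj (r := r) hy
  obtain ⟨⟨b, a⟩, h⟩ := (bijective_add_mul hK hL hY).2 y
  have h : algebraMap K L a + algebraMap K L b * y ^ 2 ^ r = y := h
  have h2 := congrArg (· ^ 2 ^ k) h
  simp only [add_pow_char_pow (p := 2) (_ : L) _, mul_pow, algebraMap_pow_two_pow hK, hy, hY] at h2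
  have hb : algebraMap K L b = 1 := by linear_combination h2 - h
  refine ⟨a, ?_⟩
  rw [hb] at h
  linear_combination h - y ^ 2 ^ r * CharTwo.two_eq_zero (R := L)

/-- The Niho sum is `K`-homogeneous, and `z + y` has conjugate `z + y + 1` for `z ∈ K`. -/
theorem nihoSum_mul_pow_add_pow [CharP L 2] (hrk : r ≤ k) (hK : Fintype.card K = 2 ^ k) {y : L}
    (hy : y ^ 2 ^ k = y + 1) {d : K} (hd : algebraMap K L d = y ^ 2 ^ r + y) (b z : K) :
    nihoSum k r (algebraMap K L (b * z ^ 2 ^ r) + algebraMap K L b * y ^ 2 ^ r) =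
      algebraMap K L (b * (z ^ 2 ^ r + z + d)) := by
  have hzy : (algebraMap K L z + y) ^ 2 ^ k = (algebraMap K L z + y) + 1 := by
    rw [add_pow_char_pow (p := 2) (_ : L) y, algebraMap_pow_two_pow hK, hy, add_assoc]
  have h := nihoSum_pow hrk hzy
  rw [add_pow_char_pow (p := 2) (_ : L) y] at h
  rw [map_mul, map_pow, ← mul_add, nihoSum_mul (algebraMap_pow_two_pow hK b), h]
  simp only [map_mul, map_add, map_pow, hd]
  ring

/-- Every element of `L` lies in `K` or is a `K`-multiple of some `(z + y) ^ (2 ^ r)` with `z ∈ K`,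
so the values of the Niho sum are determined by homogeneity. -/
theorem exists_algebraMap_eq_nihoSum [Fintype L] [CharP K 2] [CharP L 2] (hr : 1 ≤ r) (hrk : r ≤ k)
    (hK : Fintype.card K = 2 ^ k) (hL : Fintype.card L = 2 ^ (2 * k)) (x : L) :
    ∃ c : K, algebraMap K L c = nihoSum k r x := by
  obtain ⟨y, hy⟩ := exists_pow_eq_add_one (hr.trans hrk) hK hL
  obtain ⟨d, hd⟩ := exists_algebraMap_eq_pow_add (r := r) hK hL hy
  obtain ⟨⟨b, a⟩, rfl⟩ := (bijective_add_mul hK hL (pow_two_pow_conj (r := r) hy)).2 x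
  by_cases hb : b = 0
  · refine ⟨a, ?_⟩
    simp only [hb, map_zero, zero_mul, add_zero]
    rw [nihoSum_of_pow_eq hr (algebraMap_pow_two_pow hK a)]
  · obtain ⟨z, hz⟩ := (pow_two_pow_bijective r).2 (a / b)
    have ha : a = b * z ^ 2 ^ r := by
      simp only at hz
      rw [hz, mul_div_cancel₀ a hb]
    subst ha
    exact ⟨_, (nihoSum_mul_pow_add_pow hrk hK hy hd b z).symm⟩

/-- The only `δ` with `δ ^ (d_t) = c`, `t = 2 ^ (r - 1) - 1`, is `c` itself: modulo `2 ^ k + 1`, the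
order of the group of elements of the form `δ ^ (2 ^ k - 1)`, the exponent `d_t` is congruent to the
power `2 ^ (k - r + 1)` of two. -/
theorem algebraMap_eq_pow_nihoExponent_iff [Fintype L] [CharP L 2] (hr : 1 ≤ r) (hrk : r ≤ k)
    (hK : Fintype.card K = 2 ^ k) (hL : Fintype.card L = 2 ^ (2 * k)) {c : K} (hc : c ≠ 0) (δ : L) :
    algebraMap K L c = δ ^ nihoExponent k r (2 ^ (r - 1) - 1) ↔ δ = algebraMap K L c := by
  constructor
  · intro h
    have hδ : δ ≠ 0 := by
      rintro rfl
      rw [zero_pow (by simp [nihoExponent]), map_eq_zero] at h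
      exact hc h
    have hu : (δ ^ (2 ^ k - 1)) ^ (2 ^ k + 1) = 1 := by
      have h1 : δ ^ (2 ^ (2 * k)) = δ := by rw [← hL, FiniteField.pow_card]
      refine mul_right_cancel₀ hδ ?_
      rw [← pow_mul, ← pow_succ, one_mul]
      convert h1 using 2
      obtain ⟨m, hm⟩ : ∃ m, 2 ^ k = m + 1 :=
        ⟨2 ^ k - 1, (Nat.sub_add_cancel Nat.one_le_two_pow).symm⟩
      rw [mul_comm 2 k, pow_mul, hm, Nat.add_sub_cancel]
      ring
    have hud : (δ ^ (2 ^ k - 1)) ^ nihoExponent k r (2 ^ (r - 1) - 1) = 1 := by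
      refine mul_right_cancel₀ ((map_ne_zero (algebraMap K L)).2 hc) ?_
      rw [pow_right_comm, ← h, ← pow_succ, Nat.sub_add_cancel Nat.one_le_two_pow,
        algebraMap_pow_two_pow hK, one_mul]
    have hexp : nihoExponent k r (2 ^ (r - 1) - 1) =
        (2 ^ k + 1) * ((2 ^ (r - 1) - 1) * 2 ^ (k - r)) + 2 ^ (k - r + 1) := by
      obtain ⟨m, hm⟩ : ∃ m, 2 ^ (r - 1) = m + 1 :=
        ⟨2 ^ (r - 1) - 1, (Nat.sub_add_cancel Nat.one_le_two_pow).symm⟩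
      obtain ⟨j, hj⟩ : ∃ j, 2 ^ k = j + 1 :=
        ⟨2 ^ k - 1, (Nat.sub_add_cancel Nat.one_le_two_pow).symm⟩
      have hkr : 2 * (2 ^ (r - 1) * 2 ^ (k - r)) = j + 1 := by
        rw [← hj, ← pow_add, ← pow_succ']
        congr 1
        omega
      rw [nihoExponent, hj, hm, Nat.add_sub_cancel, Nat.add_sub_cancel, pow_succ]
      rw [hm] at hkr
      linarith
    rw [hexp, pow_add, pow_mul, hu, one_pow, one_mul] at hud
    have hu1 : δ ^ (2 ^ k - 1) = 1 :=
      (pow_two_pow_bijective (K := L) (k - r + 1)).1 (by simpa using hud)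
    have hδk : δ ^ 2 ^ k = δ := by
      rw [← Nat.sub_add_cancel (Nat.one_le_two_pow (n := k)), pow_succ, hu1, one_mul]
    rw [h, pow_nihoExponent_of_pow_eq hδk]
  · rintro rfl
    rw [pow_nihoExponent_of_pow_eq (algebraMap_pow_two_pow hK c)]

end quadratic

/-! ### The Walsh transform -/

theorem trace_algebraMap_mul {K L : Type*} [Field K] [Field L] [Algebra K L] (a : L) (b : K) :
    Algebra.trace K L (a * algebraMap K L b) = b * Algebra.trace K L a := by
  rw [mul_comm, ← Algebra.smul_def, map_smul, smul_eq_mul]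

section walsh

variable {K L : Type*} [Field K] [Fintype K] [Algebra (ZMod 2) K] [Field L] [Fintype L]
  [Algebra (ZMod 2) L] [Algebra K L] {k r : ℕ}

theorem walsh_component (G : L → K) (c : K) (a : L) :
    walsh (component c G) a =
      ∑ x : L, (-1 : ℤ) ^ (Algebra.trace (ZMod 2) K (c * G x + Algebra.trace K L (a * x))).val := by
  have : IsScalarTower (ZMod 2) K L :=
    IsScalarTower.of_algebraMap_eq' (Subsingleton.elim _ _)
  simp only [walsh, component, map_add, Algebra.trace_trace]

/-- As `G` is `K`-homogeneous, substituting `c⁻¹ x` for `x` turns the component at `c` into the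
component at `1`. -/
theorem walsh_component_eq {G : L → K}
    (hG : ∀ (b : K) (x : L), G (algebraMap K L b * x) = b * G x) {c : K} (hc : c ≠ 0) (a : L) :
    walsh (component c G) a = walsh (component 1 G) ((algebraMap K L c)⁻¹ * a) := by
  have hc' : algebraMap K L c ≠ 0 := (map_ne_zero _).2 hc
  rw [walsh_component, walsh_component]
  conv_rhs => rw [← Equiv.sum_comp (Equiv.mulLeft₀ (algebraMap K L c) hc')]
  refine Finset.sum_congr rfl fun x _ => ?_
  rw [Equiv.mulLeft₀_apply, hG, one_mul]
  congr 4
  field_simp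

/-- The sum is split over the `K`-lines of `L`: on the line through `(z + y) ^ (2 ^ r)` the exponent
is `b ↦ b * (binomialMap r (Tr a + 1) z + C)`, and on `K` it is `b ↦ b * (Tr a + 1)`. So the Walsh
value is determined by the number of zeros of these linear forms, that is, by the number of
solutions of `binomialMap r (Tr a + 1) z = C`. -/
theorem walsh_component_one [CharP K 2] [CharP L 2] (hr : 1 ≤ r) (hrk : r ≤ k)
    (hgcd : Nat.gcd r k = 1)
    (hK : Fintype.card K = 2 ^ k) (hL : Fintype.card L = 2 ^ (2 * k)) {G : L → K}
    (hG : ∀ x, algebraMap K L (G x) = nihoSum k r x) {y : L} (hy : y ^ 2 ^ k = y + 1) {d : K}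
    (hd : algebraMap K L d = y ^ 2 ^ r + y) (a : L)
    [Decidable (d + Algebra.trace K L (a * y ^ 2 ^ r) ∈
      (binomialMap r (Algebra.trace K L a + 1)).range)] :
    walsh (component 1 G) a =
      if d + Algebra.trace K L (a * y ^ 2 ^ r) ∈ (binomialMap r (Algebra.trace K L a + 1)).range
        then 2 ^ k else -2 ^ k := by
  classical
  set T := Algebra.trace K L a
  set C := d + Algebra.trace K L (a * y ^ 2 ^ r) with hC
  let F : K → ℤ := fun c => (-1) ^ (Algebra.trace (ZMod 2) K c).val
  have hF : ∀ p, ∑ b : K, F (b * p) = if p = 0 then (2 : ℤ) ^ k else 0 := fun p => by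
    rw [sum_neg_one_pow_trace_mul, hK]
    norm_cast
  let h : K → K → K := fun b u =>
    G (algebraMap K L u + algebraMap K L b * y ^ 2 ^ r) +
      Algebra.trace K L (a * (algebraMap K L u + algebraMap K L b * y ^ 2 ^ r))
  have htr : ∀ b u : K, Algebra.trace K L (a * (algebraMap K L u + algebraMap K L b * y ^ 2 ^ r)) =
      u * T + b * Algebra.trace K L (a * y ^ 2 ^ r) := by
    intro b u
    rw [mul_add, map_add, trace_algebraMap_mul, mul_left_comm, mul_comm (algebraMap K L b),
      trace_algebraMap_mul]
  have hW : walsh (component 1 G) a = ∑ b : K, ∑ u : K, F (h b u) := by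
    rw [walsh_component, ← Fintype.sum_prod_type',
      ← (bijective_add_mul hK hL (pow_two_pow_conj (r := r) hy)).sum_comp]
    simp only [one_mul, F, h]
  have h0 : ∑ u : K, F (h 0 u) = if T + 1 = 0 then (2 : ℤ) ^ k else 0 := by
    rw [← hF]
    refine Finset.sum_congr rfl fun u _ => ?_
    have hGu : G (algebraMap K L u) = u := (algebraMap K L).injective <| by
      rw [hG, nihoSum_of_pow_eq hr (algebraMap_pow_two_pow hK u)]
    simp only [h]
    rw [htr, map_zero, zero_mul, zero_mul, add_zero, add_zero, hGu]
    ring_nf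
  have hb : ∀ b : K, b ≠ 0 →
      ∑ u : K, F (h b u) = ∑ z : K, F (b * (binomialMap r (T + 1) z + C)) := by
    intro b hb
    rw [← ((Equiv.mulLeft₀ b hb).bijective.comp (pow_two_pow_bijective r)).sum_comp]
    refine Finset.sum_congr rfl fun z _ => ?_
    have hGz : G (algebraMap K L (b * z ^ 2 ^ r) + algebraMap K L b * y ^ 2 ^ r) =
        b * (z ^ 2 ^ r + z + d) := (algebraMap K L).injective <| by
      rw [hG, nihoSum_mul_pow_add_pow hrk hK hy hd]
    simp only [h, Function.comp_apply, Equiv.mulLeft₀_apply]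
    rw [htr, hGz, binomialMap_apply, hC]
    ring_nf
  have hswap : ∑ b : K, ∑ z : K, F (b * (binomialMap r (T + 1) z + C)) =
      2 ^ k * ((Finset.univ.filter fun z => binomialMap r (T + 1) z = C).card : ℤ) := by
    rw [Finset.sum_comm]
    simp only [hF, CharTwo.add_eq_zero, ← Finset.sum_filter, Finset.sum_const, nsmul_eq_mul]
    ring
  have hz0 : ∑ z : K, F (0 * (binomialMap r (T + 1) z + C)) = 2 ^ k := by
    simp [F, hK]
  -- The sums over `u` and over `z` differ only for `b = 0`.
  have hdiff : ∑ b : K, (∑ u : K, F (h b u) - ∑ z : K, F (b * (binomialMap r (T + 1) z + C))) =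
      ∑ u : K, F (h 0 u) - ∑ z : K, F (0 * (binomialMap r (T + 1) z + C)) :=
    Finset.sum_eq_single 0 (fun b _ hb0 => sub_eq_zero.2 (hb b hb0)) (by simp)
  rw [Finset.sum_sub_distrib, ← hW, hswap, h0, hz0] at hdiff
  by_cases ht : T + 1 = 0
  · have hmem : C ∈ (binomialMap r (T + 1)).range := ⟨C, by simp [binomialMap_apply, ht]⟩
    have hcard : (Finset.univ.filter fun z => binomialMap r (T + 1) z = C).card = 1 :=
      Finset.card_eq_one.2 ⟨C, by ext; simp [binomialMap_apply, ht]⟩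
    rw [if_pos ht, hcard] at hdiff
    rw [if_pos hmem]
    push_cast at hdiff
    linarith
  · rw [if_neg ht] at hdiff
    split_ifs with hmem
    · rw [card_fiber_binomialMap hgcd hK ht hmem] at hdiff
      push_cast at hdiff
      linarith
    · rw [Finset.filter_false_of_mem fun z _ hz => hmem ⟨z, hz⟩, Finset.card_empty] at hdiff
      push_cast at hdiff
      linarith

end walsh

end NihoBent

theorem mainTheorem7 {K L : Type*} [Field K] [Fintype K] [Algebra (ZMod 2) K]
    [Field L] [Fintype L] [Algebra (ZMod 2) L] [Algebra K L]
    (k r : ℕ) (hr : 1 ≤ r) (hrk : r ≤ k) (hgcd : Nat.gcd r k = 1)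
    (hK : Fintype.card K = 2 ^ k) (hL : Fintype.card L = 2 ^ (2 * k)) :
    ∃ G : L → K,
      (∀ x : L, algebraMap K L (G x) = NihoBent.nihoSum k r x) ∧
      NihoBent.IsVectorialBent G ∧
      ∀ c : K, c ≠ 0 →
        (∃! δ : L, algebraMap K L c = δ ^ NihoBent.nihoExponent k r (2 ^ (r - 1) - 1)) ∧
        (∀ δ : L, algebraMap K L c = δ ^ NihoBent.nihoExponent k r (2 ^ (r - 1) - 1) →
          ∀ x : L, NihoBent.dual (NihoBent.component c G) x =
            NihoBent.dual (NihoBent.component 1 G) (δ⁻¹ * x)) ∧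
        (∀ a b : K, a ≠ 0 → b ≠ 0 → ∀ x : L,
          NihoBent.derivative (algebraMap K L a)
            (NihoBent.derivative (algebraMap K L b)
              (NihoBent.dual (NihoBent.component c G))) x = 0) := by
  classical
  have : CharP K 2 := charP_of_injective_algebraMap (algebraMap (ZMod 2) K).injective 2
  have : CharP L 2 := charP_of_injective_algebraMap (algebraMap (ZMod 2) L).injective 2
  have hk := hr.trans hrk
  choose G hG using NihoBent.exists_algebraMap_eq_nihoSum (K := K) (L := L) hr hrk hK hL
  have hom : ∀ (b : K) (x : L), G (algebraMap K L b * x) = b * G x := fun b x =>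
    (algebraMap K L).injective <| by
      rw [hG, NihoBent.nihoSum_mul (NihoBent.algebraMap_pow_two_pow hK b), map_mul, hG]
  obtain ⟨y, hy⟩ := NihoBent.exists_pow_eq_add_one (K := K) hk hK hL
  obtain ⟨d, hd⟩ := NihoBent.exists_algebraMap_eq_pow_add (r := r) hK hL hy
  have hW := NihoBent.walsh_component_one hr hrk hgcd hK hL hG hy hd
  have hdual : ∀ c : K, c ≠ 0 → ∀ x : L, NihoBent.dual (NihoBent.component c G) x =
      NihoBent.dual (NihoBent.component 1 G) ((algebraMap K L c)⁻¹ * x) := fun c hc x => by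
    rw [NihoBent.dual, NihoBent.dual, NihoBent.walsh_component_eq hom hc]
  have hdual1 : ∀ x : L, NihoBent.dual (NihoBent.component 1 G) x =
      if d + Algebra.trace K L (x * y ^ 2 ^ r) ∈
        (NihoBent.binomialMap r (Algebra.trace K L x + 1)).range then 0 else 1 := fun x => by
    have hpos : (0 : ℤ) < 2 ^ k := by positivity
    rw [NihoBent.dual, hW]
    split_ifs <;> first | rfl | omega
  refine ⟨G, hG, fun c hc a => ?_, fun c hc => ⟨⟨algebraMap K L c, ?_, ?_⟩, ?_, ?_⟩⟩
  · have hfin : Module.finrank (ZMod 2) L = 2 * k := by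
      have h := Module.card_eq_pow_finrank (K := ZMod 2) (V := L)
      rw [hL, ZMod.card] at h
      exact (Nat.pow_right_injective le_rfl h).symm
    rw [NihoBent.walsh_component_eq hom hc, hW, hfin, Nat.cast_mul, Nat.cast_ofNat,
      mul_div_cancel_left₀ _ two_ne_zero, Real.rpow_natCast]
    split_ifs <;> simp
  · exact (NihoBent.algebraMap_eq_pow_nihoExponent_iff hr hrk hK hL hc _).2 rfl
  · exact fun δ => (NihoBent.algebraMap_eq_pow_nihoExponent_iff hr hrk hK hL hc δ).1
  · intro δ hδ x
    rw [(NihoBent.algebraMap_eq_pow_nihoExponent_iff hr hrk hK hL hc δ).1 hδ, hdual c hc]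
  · intro a b _ _ x
    -- A translation by `K` does not change the trace to `K`, hence neither the binomial, and
    -- it translates the right-hand side of the equation, as `y ^ (2 ^ r)` has trace `1`.
    have htrK : ∀ e : K, Algebra.trace K L (algebraMap K L e) = 0 := fun e => by
      rw [Algebra.trace_algebraMap, NihoBent.finrank_eq_two hk hK hL, CharTwo.two_nsmul]
    have htrY : Algebra.trace K L (y ^ 2 ^ r) = 1 := (algebraMap K L).injective <| by
      rw [NihoBent.algebraMap_trace_eq_add_pow hk hK hL, NihoBent.pow_two_pow_conj hy, ← add_assoc,
        CharTwo.add_self_eq_zero, zero_add, map_one]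
    have hshift : ∀ (w : L) (e : K),
        NihoBent.dual (NihoBent.component 1 G) (w + algebraMap K L e) =
          if (d + Algebra.trace K L (w * y ^ 2 ^ r)) + e ∈
            (NihoBent.binomialMap r (Algebra.trace K L w + 1)).range then 0 else 1 := fun w e => by
      rw [hdual1, map_add, htrK, add_zero, add_mul, map_add, mul_comm (algebraMap K L e),
        NihoBent.trace_algebraMap_mul, htrY, mul_one, add_assoc]
    simp only [NihoBent.derivative, hdual c hc, mul_add, ← map_inv₀, ← map_mul]
    rw [add_assoc (algebraMap K L c⁻¹ * x), ← map_add, hshift, hshift, hshift, hdual1]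
    exact NihoBent.sum_indicator_compl_eq_zero
      (fun _ _ => NihoBent.add_mem_range_binomialMap_iff hgcd hK _) _ _ _
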